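/- All graphs are finite and simple. A *separating matching* of a graph $G$ is a matching $M$ such that $G-M$ (the edges of $M$ are deleted) has more connected components than $G$; $\mathrm{mms}(G)$ is the maximum number of edges of a separating matching of $G$, and $\mathrm{mms}(G)=0$ if there is none. An *almost $2$-factor* of $G$ is a disconnected spanning subgraph of $G$ in which exactly two vertices have degree $3$ and all other vertices have degree $2$. For cubic graphs $G_1,G_2$ and vertices $u\in V(G_1)$, $v\in V(G_2)$, a *star product* $(G_1,u)*(G_2,v)$ is any graph obtained from the disjoint union of $G_1-u$ and $G_2-v$ by joining the three neighbours of $u$ to the three neighbours of $v$ by a matching of size three. Let $H_0$ be the Heawood graph, and let $\mathcal F$ be the class of all graphs $G$ for which there is a sequence $G_0,\dots,G_m$ such that $G_0\in\{H_0,K_{3,3}\}$, each $G_{i+1}$ is a star product of $G_i$ with $H_0$ or with $K_{3,3}$, and $G_m\cong G$. For $k\in\{0,1,2,3\}$ let $\overline F_k$ be the graph on $6+4k$ vertices obtained from $K_{3,3}$ by replacing $k$ vertices of one colour class, each by a copy of $K_{2,3}$ whose three vertices of degree $2$ are joined by a matching to the three vertices of the other colour class. **Theorem.** The graphs $\overline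 F_0,\overline F_1,\overline F_2,\overline F_3$ belong to $\mathcal F$. For every graph $G\in\mathcal F$ on $n$ vertices, $$\mathrm{mms}(G)\ge \frac n2-1 \iff G\not\cong\overline F_k\ \text{ for all } k\in\{0,1,2,3\} \iff G \text{ has an almost } 2\text{-factor}.$$ In particular, every graph in $\mathcal F$ other than these four has $\mathrm{mms}(G)\ge n/2-1$, and these four do not. -/

import Mathlib

universe u v

namespace SeparatingMatching

variable {V : Type u} {W : Type v}

/-- A separating matching of a graph: a matching whose removal (of its edges) increases the number
of connected components. -/
def IsSeparatingMatching (G : SimpleGraph V) (M : G.Subgraph) : Prop :=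
  M.IsMatching ∧
    Nat.card G.ConnectedComponent < Nat.card (G.deleteEdges M.edgeSet).ConnectedComponent

/-- The maximum number of edges of a separating matching of a (finite) graph; it is `0` if there is
no separating matching. -/
noncomputable def mms (G : SimpleGraph V) : ℕ :=
  sSup {k : ℕ | ∃ M : G.Subgraph, IsSeparatingMatching G M ∧ M.edgeSet.ncard = k}

/-- An almost 2-factor of `G`: a disconnected spanning subgraph with exactly two vertices of
degree `3` in which all other vertices have degree `2`. -/
def IsAlmostTwoFactor (G H : SimpleGraph V) : Prop :=
  H ≤ G ∧ ¬ H.Connected ∧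
    {x : V | (H.neighborSet x).ncard = 3}.ncard = 2 ∧
    ∀ x : V, (H.neighborSet x).ncard ≠ 3 → (H.neighborSet x).ncard = 2

/-- The star product `(G₁, a) * (G₂, b)` in which the neighbours of `a` are joined to the
neighbours of `b` by the matching `σ`: the disjoint union of `G₁ - a` and `G₂ - b` together with
the edges from `x` to `σ x`, for `x` a neighbour of `a`. -/
def starProduct (G₁ : SimpleGraph V) (G₂ : SimpleGraph W) (a : V) (b : W)
    (σ : G₁.neighborSet a ≃ G₂.neighborSet b) :
    SimpleGraph ({x : V // x ≠ a} ⊕ {y : W // y ≠ b}) :=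
  SimpleGraph.fromRel fun p q =>
    match p, q with
    | .inl x, .inl x' => G₁.Adj x x'
    | .inr y, .inr y' => G₂.Adj y y'
    | .inl x, .inr y => ∃ h : (x : V) ∈ G₁.neighborSet a, (σ ⟨x, h⟩ : W) = y
    | .inr _, .inl _ => False

/-- The complete bipartite graph `K_{3,3}`. -/
abbrev K33 : SimpleGraph (Fin 3 ⊕ Fin 3) := completeBipartiteGraph (Fin 3) (Fin 3)

/-- The Heawood graph: the incidence graph of the Fano plane, whose points are `p ∈ ℤ/7` and whose
lines are the translates `{l, l + 1, l + 3}`, `l ∈ ℤ/7`. -/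
def heawood : SimpleGraph (ZMod 7 ⊕ ZMod 7) :=
  SimpleGraph.fromRel fun s t =>
    match s, t with
    | .inl p, .inr l => p = l ∨ p = l + 1 ∨ p = l + 3
    | _, _ => False

/-- The class (closed under isomorphism) of the graphs that arise from the Heawood graph or
`K_{3,3}` by applying finitely many times the star product with the Heawood graph or `K_{3,3}`. -/
inductive FunkClass : {V : Type u} → SimpleGraph V → Prop
  | heawood {V : Type u} {G : SimpleGraph V} (e : G ≃g SeparatingMatching.heawood) : FunkClass G
  | k33 {V : Type u} {G : SimpleGraph V} (e : G ≃g K33) : FunkClass G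
  | starHeawood {V V' : Type u} {G : SimpleGraph V} {G' : SimpleGraph V'} (hG : FunkClass G)
      (a : V) (b : ZMod 7 ⊕ ZMod 7)
      (σ : G.neighborSet a ≃ SeparatingMatching.heawood.neighborSet b)
      (e : G' ≃g starProduct G SeparatingMatching.heawood a b σ) : FunkClass G'
  | starK33 {V V' : Type u} {G : SimpleGraph V} {G' : SimpleGraph V'} (hG : FunkClass G)
      (a : V) (b : Fin 3 ⊕ Fin 3) (σ : G.neighborSet a ≃ K33.neighborSet b)
      (e : G' ≃g starProduct G K33 a b σ) : FunkClass G'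

/-- The four exceptional graphs, on `6`, `10`, `14` and `18` vertices: `Fbar k` is obtained from
`K_{3,3}` by replacing `k` vertices of one colour class, each by a copy of `K_{2,3}` whose three
vertices of degree `2` are matched to the three vertices of the other colour class.
The first summand is the untouched colour class, the second one holds the `k` copies of `K_{2,3}`,
and the third one the `3 - k` vertices that are not replaced. -/
def Fbar (k : Fin 4) :
    SimpleGraph (Fin 3 ⊕ (Fin (k : ℕ) × (Fin 3 ⊕ Fin 2)) ⊕ Fin (3 - (k : ℕ))) :=
  SimpleGraph.fromRel fun s t =>
    match s, t with
    | .inl i, .inr (.inl (_, .inl i')) => i = i'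
    | .inr (.inl (j, .inl _)), .inr (.inl (j', .inr _)) => j = j'
    | .inl _, .inr (.inr _) => True
    | _, _ => False

end SeparatingMatching

open SeparatingMatching

/- In a connected cubic graph on `n` vertices the edges outside of an almost 2-factor form a
matching that misses exactly the two vertices of degree 3, so it is separating and has `n / 2 - 1`
edges. In `Fbar k`, where `n = 6 + 4 * k`, a matching with at least `2 * k + 2` edges has an edge
inside every copy of `K_{2,3}`, since its edges could otherwise be covered by `2 * k + 1` vertices.
Then it cannot separate, so `mms (Fbar k) ≤ 2 * k + 1 < n / 2 - 1`.

It remains to find an almost 2-factor in every star product in the class that is not some `Fbar k`.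
An almost 2-factor of `G` with degree 2 at the contracted vertex `a` is completed by a 2-factor of
the other factor. If `a` has odd degree in it, it is completed by a subgraph of `K_{3,3}` with one
further vertex of degree 3. The Heawood graph has an almost 2-factor with degree 2 at any given
vertex, which is completed by a 2-factor of `G`. In `Fbar k` every vertex `a` is the odd root of a
suitable disconnected subgraph, except, up to automorphisms, the `3 - k` vertices that are not
replaced; these turn `Fbar k` into `Fbar (k + 1)`. -/

namespace SeparatingMatching

section Connectivity

variable {V : Type*} {G : SimpleGraph V}

theorem preconnected_iff_forall_coloring :
    G.Preconnected ↔
      ∀ c : V → Prop, (∀ v w, G.Adj v w → (c v ↔ c w)) → ∀ v w, c v ↔ c w := by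
  refine ⟨fun h c hc v w => ?_, fun h v w => ?_⟩
  · obtain ⟨p⟩ := h v w
    induction p with
    | nil => exact Iff.rfl
    | cons hadj _ ih => exact (hc _ _ hadj).trans ih
  · refine (h (G.Reachable v) (fun x y hxy => ?_) v w).1 (SimpleGraph.Reachable.refl v)
    exact ⟨fun hx => hx.trans hxy.reachable, fun hy => hy.trans hxy.symm.reachable⟩

theorem not_connected_of_coloring {c : V → Prop} (hc : ∀ v w, G.Adj v w → (c v ↔ c w)) {v w : V}
    (hv : c v) (hw : ¬ c w) : ¬ G.Connected := fun h =>
  hw ((preconnected_iff_forall_coloring.1 h.preconnected c hc v w).1 hv)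

end Connectivity

section Degree

variable {V W : Type*} {G H : SimpleGraph V} {d : ℕ} {a c : V}

/-- The degree of a vertex, in the form used by `IsAlmostTwoFactor`: it needs no finiteness
instance and is `0` at a vertex of infinite degree. -/
noncomputable abbrev deg (G : SimpleGraph V) (v : V) : ℕ := (G.neighborSet v).ncard

theorem deg_eq_degree (G : SimpleGraph V) (v : V) [Fintype (G.neighborSet v)] :
    deg G v = G.degree v :=
  (Set.ncard_eq_toFinset_card' _).trans rfl

theorem deg_iso {G' : SimpleGraph W} (e : G ≃g G') (v : V) : deg G v = deg G' (e v) :=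
  Set.ncard_congr' (e.mapNeighborSet v)

theorem nontrivial_of_deg_ne_zero (h : deg G a ≠ 0) : Nontrivial V := by
  obtain ⟨x, hx⟩ := Set.nonempty_of_ncard_ne_zero h
  exact ⟨a, x, hx.ne⟩

/-- All degrees are `d`: a cubic graph is a `3`-regular one, and a `2`-factor of `G` is a
`2`-regular `H ≤ G`. -/
def IsRegular (G : SimpleGraph V) (d : ℕ) : Prop := ∀ v, deg G v = d

/-- All vertices have degree `2`, except for the branch vertex `c` of degree `3` and the root `a`,
whose degree is arbitrary. If it is `3` and `H` is a disconnected spanning subgraph of `G`, then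
`H` is an almost `2`-factor of `G`. -/
def IsNearTwoFactor (H : SimpleGraph V) (a c : V) : Prop :=
  a ≠ c ∧ deg H c = 3 ∧ ∀ v, v ≠ a → v ≠ c → deg H v = 2

theorem IsNearTwoFactor.symm (h : IsNearTwoFactor H a c) (ha : deg H a = 3) :
    IsNearTwoFactor H c a :=
  ⟨h.1.symm, ha, fun v hv hv' => h.2.2 v hv' hv⟩

instance [Fintype V] [DecidableEq V] [DecidableRel G.Adj] : Decidable (IsRegular G d) :=
  decidable_of_iff (∀ v, G.degree v = d) (by simp only [IsRegular, deg_eq_degree])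

instance [Fintype V] [DecidableEq V] [DecidableRel H.Adj] : Decidable (IsNearTwoFactor H a c) :=
  decidable_of_iff (a ≠ c ∧ H.degree c = 3 ∧ ∀ v, v ≠ a → v ≠ c → H.degree v = 2)
    (by simp only [IsNearTwoFactor, deg_eq_degree])

theorem isAlmostTwoFactor_iff : IsAlmostTwoFactor G H ↔
    H ≤ G ∧ ¬ H.Connected ∧ ∃ p q, IsNearTwoFactor H p q ∧ deg H p = 3 := by
  refine and_congr_right fun _ => and_congr_right fun _ => ⟨?_, ?_⟩
  · rintro ⟨h3, h2⟩
    obtain ⟨p, q, hpq, hset⟩ := Set.ncard_eq_two.1 h3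
    have hmem (v : V) : deg H v = 3 ↔ v = p ∨ v = q := by
      simpa only [Set.mem_ofPred_eq, Set.mem_insert_iff, Set.mem_singleton_iff]
        using Set.ext_iff.1 hset v
    exact ⟨p, q, ⟨hpq, (hmem q).2 (.inr rfl), fun v hp hq =>
      h2 v fun h => ((hmem v).1 h).elim hp hq⟩, (hmem p).2 (.inl rfl)⟩
  · rintro ⟨p, q, ⟨hpq, hq, h2⟩, hp⟩
    have hset : {v | deg H v = 3} = {p, q} := by
      ext v
      refine ⟨fun hv => ?_, ?_⟩
      · by_contra! hne
        simp only [Set.mem_insert_iff, Set.mem_singleton_iff, not_or] at hne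
        exact absurd (hv.symm.trans (h2 v hne.1 hne.2)) (by decide)
      · rintro (rfl | rfl) <;> assumption
    refine ⟨hset ▸ Set.ncard_pair hpq, fun v hv => h2 v ?_ ?_⟩ <;> rintro rfl <;> contradiction

end Degree

section Factors

variable {V W : Type*} {G : SimpleGraph V} {G' : SimpleGraph W} {d : ℕ} {a b : V}

/-- Every edge is missed by some `d`-factor. -/
def EdgesAvoidable (G : SimpleGraph V) (d : ℕ) : Prop :=
  ∀ x y, G.Adj x y → ∃ H ≤ G, IsRegular H d ∧ ¬ H.Adj x y

theorem EdgesAvoidable.exists_neighborSet_eq (h : EdgesAvoidable G d) (hG : IsRegular G (d + 1))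
    {S : Set V} (hS : S ⊆ G.neighborSet b) (hcard : S.ncard = d) :
    ∃ H ≤ G, H.neighborSet b = S ∧ IsRegular H d := by
  have hfin : (G.neighborSet b).Finite :=
    Set.finite_of_ncard_ne_zero ((hG b).trans_ne d.succ_ne_zero)
  have hdiff : (G.neighborSet b \ S).ncard = 1 := by
    rw [Set.ncard_sdiff hS (hfin.subset hS), hcard, show (G.neighborSet b).ncard = d + 1 from hG b,
      Nat.add_sub_cancel_left]
  obtain ⟨y, hy⟩ := Set.ncard_eq_one.1 hdiff
  have hyb : G.Adj b y := (hy.ge rfl).1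
  obtain ⟨H, hle, hreg, hxy⟩ := h b y hyb
  refine ⟨H, hle, Set.eq_of_subset_of_ncard_le (fun z hz => ?_)
    (hcard.trans (hreg b).symm).le (hfin.subset hS), hreg⟩
  by_contra hzS
  obtain rfl : z = y := hy.le ⟨hle hz, hzS⟩
  exact hxy hz

/-- `G` has a disconnected spanning subgraph with exactly two vertices of odd degree, one of them
`a`, in which the other one has degree `3`. Replacing `a` by a graph with similar subgraphs turns
it into an almost `2`-factor. -/
def HasDisconnectedNearTwoFactor (G : SimpleGraph V) (a : V) : Prop :=
  ∃ H ≤ G, ¬ H.Connected ∧ Odd (deg H a) ∧ ∃ c, IsNearTwoFactor H a c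

theorem deg_comap (e : V ≃ W) (H : SimpleGraph W) (v : V) : deg (H.comap e) v = deg H (e v) :=
  deg_iso (SimpleGraph.Iso.comap e H) v

theorem comap_le_of_iso (e : G ≃g G') {H : SimpleGraph W} (h : H ≤ G') : H.comap e.toEquiv ≤ G :=
  fun _ _ hxy => e.map_adj_iff.1 (h hxy)

theorem not_connected_comap (e : V ≃ W) {H : SimpleGraph W} (h : ¬ H.Connected) :
    ¬ (H.comap e).Connected := fun h' =>
  h ((SimpleGraph.Iso.comap e H).connected_iff.1 h')

theorem IsNearTwoFactor.comap {H : SimpleGraph W} {p q : W} (h : IsNearTwoFactor H p q)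
    (e : V ≃ W) : IsNearTwoFactor (H.comap e) (e.symm p) (e.symm q) := by
  refine ⟨e.symm.injective.ne h.1, by rw [deg_comap, e.apply_symm_apply, h.2.1],
    fun v hp hq => ?_⟩
  rw [deg_comap]
  exact h.2.2 _ (mt e.eq_symm_apply.2 hp) (mt e.eq_symm_apply.2 hq)

theorem IsRegular.of_iso (e : G ≃g G') (h : IsRegular G' d) : IsRegular G d := fun v =>
  (deg_iso e v).trans (h (e v))

theorem EdgesAvoidable.of_iso (e : G ≃g G') (h : EdgesAvoidable G' d) : EdgesAvoidable G d := by
  intro x y hxy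
  obtain ⟨H, hle, hreg, hH⟩ := h _ _ (e.map_adj_iff.2 hxy)
  exact ⟨H.comap e.toEquiv, comap_le_of_iso e hle,
    hreg.of_iso (SimpleGraph.Iso.comap e.toEquiv H), hH⟩

theorem HasDisconnectedNearTwoFactor.of_iso (e : G ≃g G')
    (h : HasDisconnectedNearTwoFactor G' (e a)) : HasDisconnectedNearTwoFactor G a := by
  obtain ⟨H, hle, hdis, hodd, c, hH⟩ := h
  refine ⟨H.comap e.toEquiv, comap_le_of_iso e hle, not_connected_comap e.toEquiv hdis, ?_,
    e.symm c, ?_⟩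
  · rwa [deg_comap]
  · exact e.symm_apply_apply a ▸ hH.comap e.toEquiv

theorem IsAlmostTwoFactor.comap (e : G ≃g G') {H : SimpleGraph W} (h : IsAlmostTwoFactor G' H) :
    IsAlmostTwoFactor G (H.comap e.toEquiv) := by
  obtain ⟨hle, hdis, p, q, hpq, hp⟩ := isAlmostTwoFactor_iff.1 h
  refine isAlmostTwoFactor_iff.2 ⟨comap_le_of_iso e hle, not_connected_comap e.toEquiv hdis,
    e.symm p, e.symm q, hpq.comap e.toEquiv, ?_⟩
  rw [deg_comap, ← hp]
  exact congrArg _ (e.apply_symm_apply p)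

end Factors

section StarProduct

variable {V W : Type*} {G₁ H₁ : SimpleGraph V} {G₂ H₂ : SimpleGraph W} {a : V} {b : W}
  (σ : G₁.neighborSet a ≃ G₂.neighborSet b)

@[simp] theorem starProduct_adj_inl_inl (x x' : {x : V // x ≠ a}) :
    (starProduct G₁ G₂ a b σ).Adj (.inl x) (.inl x') ↔ G₁.Adj x x' := by
  simp only [starProduct, SimpleGraph.fromRel_adj, G₁.adj_comm x' x, or_self,
    and_iff_right_iff_imp]
  rintro h ⟨⟩
  exact h.ne rfl

@[simp] theorem starProduct_adj_inr_inr (y y' : {y : W // y ≠ b}) :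
    (starProduct G₁ G₂ a b σ).Adj (.inr y) (.inr y') ↔ G₂.Adj y y' := by
  simp only [starProduct, SimpleGraph.fromRel_adj, G₂.adj_comm y' y, or_self,
    and_iff_right_iff_imp]
  rintro h ⟨⟩
  exact h.ne rfl

@[simp] theorem starProduct_adj_inl_inr (x : {x : V // x ≠ a}) (y : {y : W // y ≠ b}) :
    (starProduct G₁ G₂ a b σ).Adj (.inl x) (.inr y) ↔
      ∃ h : (x : V) ∈ G₁.neighborSet a, (σ ⟨x, h⟩ : W) = y := by
  simp [starProduct]

@[simp] theorem starProduct_adj_inr_inl (x : {x : V // x ≠ a}) (y : {y : W // y ≠ b}) :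
    (starProduct G₁ G₂ a b σ).Adj (.inr y) (.inl x) ↔
      ∃ h : (x : V) ∈ G₁.neighborSet a, (σ ⟨x, h⟩ : W) = y := by
  rw [SimpleGraph.adj_comm, starProduct_adj_inl_inr]

theorem starProduct_adj_apply {x : V} (h : x ∈ G₁.neighborSet a) :
    (starProduct G₁ G₂ a b σ).Adj (.inl ⟨x, h.ne'⟩) (.inr ⟨σ ⟨x, h⟩, (σ ⟨x, h⟩).2.ne'⟩) :=
  (starProduct_adj_inl_inr σ _ _).2 ⟨h, rfl⟩

/-- The star product is commutative. -/
def starProductComm : starProduct G₁ G₂ a b σ ≃g starProduct G₂ G₁ b a σ.symm where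
  toEquiv := Equiv.sumComm _ _
  map_rel_iff' := by
    have hcut (x : V) (y : W) : (∃ h : y ∈ G₂.neighborSet b, (σ.symm ⟨y, h⟩ : V) = x) ↔
        ∃ h : x ∈ G₁.neighborSet a, (σ ⟨x, h⟩ : W) = y := by
      constructor <;> rintro ⟨h, rfl⟩ <;> simp
    rintro (x | y) (x' | y') <;>
      simp only [Equiv.sumComm_apply, Sum.swap_inl, Sum.swap_inr, starProduct_adj_inl_inl,
        starProduct_adj_inr_inr, starProduct_adj_inl_inr, starProduct_adj_inr_inl, hcut]

/-- The map that contracts the right-hand factor of a star product to the vertex `a` it is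
attached at. -/
def contract (a : V) (b : W) : {x : V // x ≠ a} ⊕ {y : W // y ≠ b} → V :=
  Sum.elim Subtype.val fun _ => a

theorem starProduct_adj_contract {x : {x : V // x ≠ a}} {q : {x : V // x ≠ a} ⊕ {y : W // y ≠ b}}
    (h : (starProduct G₁ G₂ a b σ).Adj (.inl x) q) : G₁.Adj x (contract a b q) := by
  rcases q with x' | y
  · exact (starProduct_adj_inl_inl σ x x').1 h
  · obtain ⟨hx, -⟩ := (starProduct_adj_inl_inr σ x y).1 h
    exact hx.symm

theorem deg_starProduct_inl (x : {x : V // x ≠ a}) :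
    deg (starProduct G₁ G₂ a b σ) (.inl x) = deg G₁ x := by
  refine Set.BijOn.ncard_eq (f := contract a b)
    ⟨fun q hq => starProduct_adj_contract σ hq, ?_, fun z hz => ?_⟩
  · rintro (x₁ | y₁) h₁ (x₂ | y₂) h₂ h
    · exact congrArg _ (Subtype.ext h)
    · exact absurd h x₁.2
    · exact absurd h.symm x₂.2
    · obtain ⟨_, e₁⟩ := (starProduct_adj_inl_inr σ x y₁).1 h₁
      obtain ⟨_, e₂⟩ := (starProduct_adj_inl_inr σ x y₂).1 h₂
      exact congrArg _ (Subtype.ext (e₁.symm.trans e₂))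
  · by_cases hza : z = a
    · subst hza
      exact ⟨_, starProduct_adj_apply σ hz.symm, rfl⟩
    · exact ⟨.inl ⟨z, hza⟩, (starProduct_adj_inl_inl σ _ _).2 hz, rfl⟩

theorem deg_starProduct_inr (y : {y : W // y ≠ b}) :
    deg (starProduct G₁ G₂ a b σ) (.inr y) = deg G₂ y :=
  (deg_iso (starProductComm σ) _).trans (deg_starProduct_inl σ.symm y)

theorem IsRegular.starProduct {d : ℕ} (h₁ : IsRegular G₁ d) (h₂ : IsRegular G₂ d) :
    IsRegular (starProduct G₁ G₂ a b σ) d := by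
  rintro (x | y)
  · exact (deg_starProduct_inl σ x).trans (h₁ x)
  · exact (deg_starProduct_inr σ y).trans (h₂ y)

theorem IsNearTwoFactor.starProduct {p : V} {c : W} (h₁ : IsNearTwoFactor G₁ a p)
    (h₂ : IsNearTwoFactor G₂ b c) :
    IsNearTwoFactor (starProduct G₁ G₂ a b σ) (.inl ⟨p, h₁.1.symm⟩) (.inr ⟨c, h₂.1.symm⟩) := by
  refine ⟨Sum.inl_ne_inr, (deg_starProduct_inr σ _).trans h₂.2.1, ?_⟩
  rintro (x | y) hx hy
  · exact (deg_starProduct_inl σ x).trans (h₁.2.2 x x.2 fun h => hx (congrArg _ (Subtype.ext h)))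
  · exact (deg_starProduct_inr σ y).trans (h₂.2.2 y y.2 fun h => hy (congrArg _ (Subtype.ext h)))

theorem IsNearTwoFactor.starProduct_isRegular {p q : V} (h₁ : IsNearTwoFactor G₁ p q) (hp : p ≠ a)
    (hq : q ≠ a) (h₂ : IsRegular G₂ 2) :
    IsNearTwoFactor (SeparatingMatching.starProduct G₁ G₂ a b σ) (.inl ⟨p, hp⟩) (.inl ⟨q, hq⟩) := by
  refine ⟨fun h => h₁.1 (congrArg Subtype.val (Sum.inl.inj h)),
    (deg_starProduct_inl σ _).trans h₁.2.1, ?_⟩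
  rintro (x | y) hx hy
  · exact (deg_starProduct_inl σ x).trans (h₁.2.2 x (fun h => hx (congrArg _ (Subtype.ext h)))
      fun h => hy (congrArg _ (Subtype.ext h)))
  · exact (deg_starProduct_inr σ y).trans (h₂ y)

theorem connected_left_of_starProduct [Nontrivial W]
    (h : (starProduct G₁ G₂ a b σ).Connected) : G₁.Connected := by
  have : Nonempty V := ⟨a⟩
  refine ⟨preconnected_iff_forall_coloring.2 fun c hc => ?_⟩
  have hconst := preconnected_iff_forall_coloring.1 h.preconnected (c ∘ contract a b) ?_
  · have hsurj : Function.Surjective (contract a b) := fun v => by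
      obtain ⟨y, hy⟩ := exists_ne b
      by_cases hv : v = a
      exacts [⟨.inr ⟨y, hy⟩, hv.symm⟩, ⟨.inl ⟨v, hv⟩, rfl⟩]
    exact hsurj.forall₂.2 hconst
  · rintro (x | y) (x' | y') hadj
    · exact hc _ _ (starProduct_adj_contract σ hadj)
    · exact hc _ _ (starProduct_adj_contract σ hadj)
    · exact (hc _ _ (starProduct_adj_contract σ hadj.symm)).symm
    · exact Iff.rfl

theorem connected_starProduct (h₁ : G₁.Connected) (h₂ : (G₂.induce {b}ᶜ).Connected) :
    (starProduct G₁ G₂ a b σ).Connected := by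
  obtain ⟨y₀⟩ := h₂.nonempty
  have : Nonempty ({x : V // x ≠ a} ⊕ {y : W // y ≠ b}) := ⟨.inr y₀⟩
  refine ⟨preconnected_iff_forall_coloring.2 fun c hc => ?_⟩
  have hright (y : {y : W // y ≠ b}) : c (.inr y) ↔ c (.inr y₀) :=
    preconnected_iff_forall_coloring.1 h₂.preconnected (fun y => c (.inr y))
      (fun y y' hadj => hc _ _ ((starProduct_adj_inr_inr σ y y').2 hadj)) y y₀
  have hleft (x : {x : V // x ≠ a}) : c (.inl x) ↔ c (.inr y₀) := by
    classical
    let c' (v : V) : Prop := if hv : v ≠ a then c (.inl ⟨v, hv⟩) else c (.inr y₀)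
    have hc' (v w : V) (hadj : G₁.Adj v w) : c' v ↔ c' w := by
      by_cases hv : v = a <;> by_cases hw : w = a
      · exact absurd (hv.trans hw.symm) hadj.ne
      · subst hv
        simpa [c', hw, hright] using (hc _ _ (starProduct_adj_apply σ hadj)).symm
      · subst hw
        simpa [c', hv, hright] using hc _ _ (starProduct_adj_apply σ hadj.symm)
      · simpa [c', hv, hw] using hc _ _ ((starProduct_adj_inl_inl σ ⟨v, hv⟩ ⟨w, hw⟩).2 hadj)
    simpa [c', x.2] using preconnected_iff_forall_coloring.1 h₁.preconnected c' hc' x a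
  have hall (p : {x : V // x ≠ a} ⊕ {y : W // y ≠ b}) : c p ↔ c (.inr y₀) := by
    rcases p with x | y
    exacts [hleft x, hright y]
  exact fun p q => (hall p).trans (hall q).symm

theorem exists_starProduct_le (h₁ : H₁ ≤ G₁) {Q : SimpleGraph W → Prop}
    (hQ : ∀ T ⊆ G₂.neighborSet b, T.ncard = deg H₁ a →
      ∃ H₂ ≤ G₂, H₂.neighborSet b = T ∧ Q H₂) :
    ∃ H₂, Q H₂ ∧ ∃ τ : H₁.neighborSet a ≃ H₂.neighborSet b,
      starProduct H₁ H₂ a b τ ≤ starProduct G₁ G₂ a b σ := by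
  let f (x : H₁.neighborSet a) : W := σ ⟨x, h₁ x.2⟩
  have hf : Function.Injective f := fun x x' h =>
    Subtype.ext (Subtype.mk.inj (σ.injective (Subtype.ext h)))
  obtain ⟨H₂, h₂, hT, hQ⟩ := hQ (Set.range f) (Set.range_subset_iff.2 fun x => (σ _).2)
    (Set.ncard_congr' (Equiv.ofInjective f hf).symm)
  refine ⟨H₂, hQ, (Equiv.ofInjective f hf).trans (Equiv.setCongr hT.symm), ?_⟩
  rintro (x | y) (x' | y') h <;>
    simp only [starProduct_adj_inl_inl, starProduct_adj_inr_inr, starProduct_adj_inl_inr,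
      starProduct_adj_inr_inl] at h ⊢
  · exact h₁ h
  · exact ⟨h₁ h.1, h.2⟩
  · exact ⟨h₁ h.1, h.2⟩
  · exact h₂ h

variable {σ}

theorem exists_isRegular_not_adj_starProduct {d : ℕ} (hr₂ : IsRegular G₂ (d + 1))
    (he₁ : EdgesAvoidable G₁ d) (he₂ : EdgesAvoidable G₂ d) {x : {x : V // x ≠ a}}
    {q : {x : V // x ≠ a} ⊕ {y : W // y ≠ b}}
    (hxq : (starProduct G₁ G₂ a b σ).Adj (.inl x) q) :
    ∃ H ≤ starProduct G₁ G₂ a b σ, IsRegular H d ∧ ¬ H.Adj (.inl x) q := by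
  obtain ⟨H₁, h₁, hr, hadj⟩ := he₁ _ _ (starProduct_adj_contract σ hxq)
  obtain ⟨H₂, hr', τ, hle⟩ := exists_starProduct_le σ h₁ fun T hT hcard =>
    he₂.exists_neighborSet_eq hr₂ hT (hcard.trans (hr a))
  exact ⟨_, hle, hr.starProduct τ hr', fun h => hadj (starProduct_adj_contract τ h)⟩

theorem EdgesAvoidable.starProduct {d : ℕ} (he₁ : EdgesAvoidable G₁ d)
    (he₂ : EdgesAvoidable G₂ d) (hr₁ : IsRegular G₁ (d + 1)) (hr₂ : IsRegular G₂ (d + 1)) :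
    EdgesAvoidable (starProduct G₁ G₂ a b σ) d := by
  rintro (x | y) q hadj
  · exact exists_isRegular_not_adj_starProduct hr₂ he₁ he₂ hadj
  · obtain ⟨H, hle, hr, hH⟩ := exists_isRegular_not_adj_starProduct hr₁ he₂ he₁
      ((starProductComm σ).map_adj_iff.2 hadj)
    exact ⟨H.comap (starProductComm σ).toEquiv, comap_le_of_iso _ hle,
      hr.of_iso (SimpleGraph.Iso.comap (starProductComm σ).toEquiv H), hH⟩

theorem exists_isAlmostTwoFactor_starProduct [Nontrivial W]
    (h₁ : HasDisconnectedNearTwoFactor G₁ a)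
    (h₂ : ∀ T ⊆ G₂.neighborSet b, Odd T.ncard →
      ∃ H₂ ≤ G₂, H₂.neighborSet b = T ∧ ∃ c, IsNearTwoFactor H₂ b c) :
    ∃ H, IsAlmostTwoFactor (starProduct G₁ G₂ a b σ) H := by
  obtain ⟨H₁, hle₁, hdis, hodd, p, hp⟩ := h₁
  obtain ⟨H₂, ⟨c, hc⟩, τ, hle⟩ := exists_starProduct_le σ hle₁ fun T hT hcard =>
    h₂ T hT (hcard ▸ hodd)
  exact ⟨_, isAlmostTwoFactor_iff.2 ⟨hle, mt (connected_left_of_starProduct τ) hdis, _, _,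
    hp.starProduct τ hc, (deg_starProduct_inl τ _).trans hp.2.1⟩⟩

theorem exists_isAlmostTwoFactor_starProduct_of_ne (hr₂ : IsRegular G₂ 3)
    (he₂ : EdgesAvoidable G₂ 2) (hle₁ : H₁ ≤ G₁) (hdis : ¬ H₁.Connected) {p q : V}
    (hH₁ : IsNearTwoFactor H₁ p q) (hp : deg H₁ p = 3) (hpa : p ≠ a) (hqa : q ≠ a) :
    ∃ H, IsAlmostTwoFactor (starProduct G₁ G₂ a b σ) H := by
  have : Nontrivial W := nontrivial_of_deg_ne_zero (by rw [hr₂ b]; decide)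
  obtain ⟨H₂, hr, τ, hle⟩ := exists_starProduct_le σ hle₁ fun T hT hcard =>
    he₂.exists_neighborSet_eq hr₂ hT (hcard.trans (hH₁.2.2 a hpa.symm hqa.symm))
  exact ⟨_, isAlmostTwoFactor_iff.2 ⟨hle, mt (connected_left_of_starProduct τ) hdis, _, _,
    hH₁.starProduct_isRegular τ hpa hqa hr, (deg_starProduct_inl τ _).trans hp⟩⟩

end StarProduct

section Congruence

variable {V V' W : Type*} {G : SimpleGraph V} {G' : SimpleGraph V'} {G₂ : SimpleGraph W}

/-- An isomorphism of the left-hand factors extends to the star products. -/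
def starProductCongrLeft (e : G ≃g G') (a : V) (b : W) (σ : G.neighborSet a ≃ G₂.neighborSet b) :
    starProduct G G₂ a b σ ≃g
      starProduct G' G₂ (e a) b ((e.mapNeighborSet a).symm.trans σ) where
  toEquiv := Equiv.sumCongr (e.toEquiv.subtypeEquiv fun _ => e.injective.ne_iff.symm)
    (Equiv.refl _)
  map_rel_iff' := by
    have hcut (x : V) (y : W) :
        (∃ h : e x ∈ G'.neighborSet (e a),
          (((e.mapNeighborSet a).symm.trans σ) ⟨e x, h⟩ : W) = y) ↔
          ∃ h : x ∈ G.neighborSet a, (σ ⟨x, h⟩ : W) = y := by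
      have hsymm (h : e x ∈ G'.neighborSet (e a)) : (e.mapNeighborSet a).symm ⟨e x, h⟩ =
          ⟨x, e.map_adj_iff.1 h⟩ := Subtype.ext (e.symm_apply_apply x)
      simp only [Equiv.trans_apply, hsymm, SimpleGraph.mem_neighborSet, e.map_adj_iff]
    rintro (x | y) (x' | y')
    · simpa using e.map_adj_iff
    · simpa using hcut x y'
    · simpa using hcut x' y
    · simp

end Congruence

section Tour

variable {V : Type*} {G : SimpleGraph V} {f : Equiv.Perm V} {b : V}

theorem connected_of_iterate_eq (hf : ∀ v, G.Adj v (f v)) (hb : ∀ v, ∃ n, f^[n] v = b) :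
    G.Connected := by
  have : Nonempty V := ⟨b⟩
  refine ⟨preconnected_iff_forall_coloring.2 fun c hc => ?_⟩
  have hiter (n : ℕ) : ∀ v, f^[n] v = b → (c v ↔ c b) := by
    induction n with
    | zero => rintro v rfl; rfl
    | succ n ih => exact fun v hv => (hc v _ (hf v)).trans (ih _ hv)
  have hall (v : V) : c v ↔ c b := (hb v).elim fun n => hiter n v
  exact fun v w => (hall v).trans (hall w).symm

theorem connected_induce_compl_of_iterate_eq (hf : ∀ v, G.Adj v (f v))
    (hb : ∀ v, ∃ n, f^[n] v = b) : (G.induce {b}ᶜ).Connected := by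
  have hpred : f.symm b ≠ b := fun h => (hf b).ne (f.symm_apply_eq.1 h)
  have : Nonempty ({b}ᶜ : Set V) := ⟨⟨f.symm b, hpred⟩⟩
  refine ⟨preconnected_iff_forall_coloring.2 fun c hc => ?_⟩
  have hiter (n : ℕ) : ∀ v (hv : v ≠ b), f^[n] v = b → (c ⟨v, hv⟩ ↔ c ⟨f.symm b, hpred⟩) := by
    induction n with
    | zero => exact fun v hv h => absurd h hv
    | succ n ih =>
      intro v hv h
      by_cases hfv : f v = b
      · obtain rfl : v = f.symm b := f.eq_symm_apply.2 hfv
        rfl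
      · exact (hc ⟨v, hv⟩ ⟨f v, hfv⟩ (hf v)).trans (ih _ hfv h)
  have hall (v : ({b}ᶜ : Set V)) : c v ↔ c ⟨f.symm b, hpred⟩ :=
    (hb v).elim fun n => hiter n v v.2
  exact fun v w => (hall v).trans (hall w).symm

end Tour

section DifferenceGraph

variable {A : Type*} [AddCommGroup A] {D : Finset A} {d : ℕ}

/-- The bipartite graph on two copies of `A` in which `p` on the left is joined to `l` on the right
if `p - l ∈ D`. For `A = ℤ/7` and the difference set `D = {0, 1, 3}` it is the Heawood graph. -/
def differenceGraph (D : Finset A) : SimpleGraph (A ⊕ A) where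
  Adj
    | .inl p, .inr l => p - l ∈ D
    | .inr l, .inl p => p - l ∈ D
    | _, _ => False
  symm := ⟨by rintro (p | p) (l | l) h <;> exact h⟩
  loopless := ⟨by rintro (p | p) h <;> exact h⟩

instance [DecidableEq A] : DecidableRel (differenceGraph D).Adj
  | .inl p, .inr l => inferInstanceAs (Decidable (p - l ∈ D))
  | .inr l, .inl p => inferInstanceAs (Decidable (p - l ∈ D))
  | .inl _, .inl _ => inferInstanceAs (Decidable False)
  | .inr _, .inr _ => inferInstanceAs (Decidable False)

theorem isRegular_differenceGraph : IsRegular (differenceGraph D) D.card := by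
  rintro (p | l) <;> rw [← Set.ncard_coe_finset]
  · refine (Set.BijOn.ncard_eq (f := fun r => .inr (p - r)) ⟨fun r hr => ?_, ?_, ?_⟩).symm
    · simpa [differenceGraph] using hr
    · exact fun r _ r' _ h => sub_right_injective (Sum.inr.inj h)
    · rintro (p' | l) h
      exacts [h.elim, ⟨p - l, h, by simp⟩]
  · refine (Set.BijOn.ncard_eq (f := fun r => .inl (l + r)) ⟨fun r hr => ?_, ?_, ?_⟩).symm
    · simpa [differenceGraph] using hr
    · exact fun r _ r' _ h => add_right_injective l (Sum.inl.inj h)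
    · rintro (p | l') h
      exacts [⟨p - l, h, by simp⟩, h.elim]

theorem edgesAvoidable_differenceGraph (hD : D.card = d + 1) :
    EdgesAvoidable (differenceGraph D) d := by
  classical
  have key (r : A) (hr : r ∈ D) : ∃ H ≤ differenceGraph D, IsRegular H d ∧
      ∀ p l : A, p - l = r → ¬ H.Adj (.inl p) (.inr l) := by
    refine ⟨differenceGraph (D.erase r), ?_, ?_, ?_⟩
    · rintro (p | p) (l | l) h
      exacts [h, Finset.mem_of_mem_erase h, Finset.mem_of_mem_erase h, h]
    · have hcard : (D.erase r).card = d := by rw [Finset.card_erase_of_mem hr, hD]; rfl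
      exact hcard ▸ isRegular_differenceGraph
    · rintro p l rfl h
      exact Finset.notMem_erase _ _ h
  rintro (p | l) (p' | l') h
  · exact h.elim
  · exact (key _ h).imp fun H hH => ⟨hH.1, hH.2.1, hH.2.2 _ _ rfl⟩
  · exact (key _ h).imp fun H hH => ⟨hH.1, hH.2.1, fun h' => hH.2.2 _ _ rfl h'.symm⟩
  · exact h.elim

variable [One A]

variable (A) in
/-- The permutation that sends `p` on the left to `p` on the right, and `p` on the right to `p + 1`
on the left. It traces a Hamiltonian cycle of `differenceGraph D` if `A` is finite and generated
by `1`, and `0, 1 ∈ D`. -/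
def tour : Equiv.Perm (A ⊕ A) :=
  (Equiv.sumComm A A).trans (Equiv.sumCongr (Equiv.addRight 1) (Equiv.refl A))

theorem differenceGraph_adj_tour (h0 : 0 ∈ D) (h1 : 1 ∈ D) (v : A ⊕ A) :
    (differenceGraph D).Adj v (tour A v) := by
  rcases v with p | l <;> simpa [differenceGraph, tour]

end DifferenceGraph

section K33

theorem K33_eq_differenceGraph : K33 = differenceGraph Finset.univ := by
  ext (p | p) (l | l) <;> simp [differenceGraph]

theorem isRegular_K33 : IsRegular K33 3 :=
  K33_eq_differenceGraph ▸ isRegular_differenceGraph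

theorem edgesAvoidable_K33 : EdgesAvoidable K33 2 :=
  K33_eq_differenceGraph ▸ edgesAvoidable_differenceGraph rfl

theorem K33_adj_tour (v : Fin 3 ⊕ Fin 3) : K33.Adj v (tour (Fin 3) v) :=
  K33_eq_differenceGraph ▸ differenceGraph_adj_tour (Finset.mem_univ _) (Finset.mem_univ _) v

theorem exists_iterate_tour_fin_three (v w : Fin 3 ⊕ Fin 3) : ∃ n, (tour (Fin 3))^[n] v = w := by
  suffices ∃ n < 6, (tour (Fin 3))^[n] v = w from this.imp fun _ h => h.2
  revert v w
  decide +kernel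

theorem connected_K33 : K33.Connected :=
  connected_of_iterate_eq K33_adj_tour fun v => exists_iterate_tour_fin_three v (.inl 0)

theorem connected_K33_induce_compl (b : Fin 3 ⊕ Fin 3) : (K33.induce {b}ᶜ).Connected :=
  connected_induce_compl_of_iterate_eq K33_adj_tour fun v => exists_iterate_tour_fin_three v b

instance {A B : Type*} : DecidableRel (completeBipartiteGraph A B).Adj :=
  fun _ _ => inferInstanceAs (Decidable (_ ∧ _ ∨ _ ∧ _))

theorem exists_isNearTwoFactor_K33_of_singleton {b n : Fin 3 ⊕ Fin 3} (h : K33.Adj b n) :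
    ∃ H ≤ K33, H.neighborSet b = {n} ∧ ∃ c, IsNearTwoFactor H b c := by
  let next (v : Fin 3 ⊕ Fin 3) : Fin 3 ⊕ Fin 3 := v.map (· + 1) (· + 1)
  let E : Finset (Sym2 (Fin 3 ⊕ Fin 3)) :=
    {s(b, next n), s(b, next (next n)), s(next (next b), n)}
  have hE : (∀ y, (K33.deleteEdges E).Adj b y ↔ y = n) ∧
      IsNearTwoFactor (K33.deleteEdges E) b (next b) := by
    revert b n
    decide +kernel
  exact ⟨_, SimpleGraph.deleteEdges_le _, Set.ext hE.1, _, hE.2⟩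

theorem exists_isNearTwoFactor_K33_of_neighborSet (b : Fin 3 ⊕ Fin 3) :
    ∃ H ≤ K33, H.neighborSet b = K33.neighborSet b ∧ ∃ c, IsNearTwoFactor H b c := by
  let next (v : Fin 3 ⊕ Fin 3) : Fin 3 ⊕ Fin 3 := v.map (· + 1) (· + 1)
  let E : Finset (Sym2 (Fin 3 ⊕ Fin 3)) :=
    {s(next b, next b.swap), s(next (next b), next (next b.swap))}
  have hE : (∀ y, (K33.deleteEdges E).Adj b y ↔ K33.Adj b y) ∧
      IsNearTwoFactor (K33.deleteEdges E) b b.swap := by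
    revert b
    decide +kernel
  exact ⟨_, SimpleGraph.deleteEdges_le _, Set.ext hE.1, _, hE.2⟩

theorem exists_isNearTwoFactor_K33 {b : Fin 3 ⊕ Fin 3} {T : Set (Fin 3 ⊕ Fin 3)}
    (hT : T ⊆ K33.neighborSet b) (hodd : Odd T.ncard) :
    ∃ H ≤ K33, H.neighborSet b = T ∧ ∃ c, IsNearTwoFactor H b c := by
  have hb : (K33.neighborSet b).ncard = 3 := isRegular_K33 b
  have hle : T.ncard ≤ 3 := (Set.ncard_le_ncard hT).trans_eq hb
  obtain h1 | h3 : T.ncard = 1 ∨ T.ncard = 3 := by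
    obtain ⟨m, hm⟩ := hodd
    omega
  · obtain ⟨n, rfl⟩ := Set.ncard_eq_one.1 h1
    exact exists_isNearTwoFactor_K33_of_singleton (hT rfl)
  · obtain rfl := Set.eq_of_subset_of_ncard_le hT (hb.trans h3.symm).le
    exact exists_isNearTwoFactor_K33_of_neighborSet b

end K33

section Heawood

theorem heawood_eq_differenceGraph : heawood = differenceGraph {0, 1, 3} := by
  ext (p | p) (l | l) <;> simp [heawood, differenceGraph, sub_eq_iff_eq_add, add_comm]

theorem isRegular_heawood : IsRegular heawood 3 :=
  heawood_eq_differenceGraph ▸ isRegular_differenceGraph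

theorem edgesAvoidable_heawood : EdgesAvoidable heawood 2 :=
  heawood_eq_differenceGraph ▸ edgesAvoidable_differenceGraph rfl

theorem heawood_adj_tour (v : ZMod 7 ⊕ ZMod 7) : heawood.Adj v (tour (ZMod 7) v) :=
  heawood_eq_differenceGraph ▸ differenceGraph_adj_tour (by decide) (by decide) v

theorem exists_iterate_tour_zmod_seven (v w : ZMod 7 ⊕ ZMod 7) :
    ∃ n, (tour (ZMod 7))^[n] v = w := by
  suffices ∃ n < 14, (tour (ZMod 7))^[n] v = w from this.imp fun _ h => h.2
  revert v w
  decide +kernel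

theorem connected_heawood : heawood.Connected :=
  connected_of_iterate_eq heawood_adj_tour fun v => exists_iterate_tour_zmod_seven v (.inl 0)

theorem connected_heawood_induce_compl (b : ZMod 7 ⊕ ZMod 7) : (heawood.induce {b}ᶜ).Connected :=
  connected_induce_compl_of_iterate_eq heawood_adj_tour fun v => exists_iterate_tour_zmod_seven v b

theorem exists_isNearTwoFactor_heawood (s : ZMod 7) : ∃ H ≤ heawood, ¬ H.Connected ∧
    IsNearTwoFactor H (.inl (4 + s)) (.inr (6 + s)) ∧ deg H (.inl (4 + s)) = 3 := by
  rw [heawood_eq_differenceGraph]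
  -- Up to translation by `s`, `E` is the edge cut around the hexagon formed by the triangle with
  -- vertices `1, 3, 5` and sides `0, 2, 5` in the Fano plane. Only the point `4` on none of the
  -- sides and the line `6` through none of the vertices keep degree 3.
  let E : Finset (Sym2 (ZMod 7 ⊕ ZMod 7)) :=
    ({(0, 0), (1, 1), (2, 2), (3, 3), (5, 4), (6, 5)} : Finset (ZMod 7 × ZMod 7)).image fun e =>
      s(.inl (e.1 + s), .inr (e.2 + s))
  let H := (differenceGraph ({0, 1, 3} : Finset (ZMod 7))).deleteEdges E
  let c : ZMod 7 ⊕ ZMod 7 → Bool := Sum.elim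
    (fun p => p - s = 0 ∨ p - s = 2 ∨ p - s = 4 ∨ p - s = 6)
    fun l => l - s = 1 ∨ l - s = 3 ∨ l - s = 4 ∨ l - s = 6
  have hc : (∀ v w, H.Adj v w → (c v ↔ c w)) ∧ c (.inl s) ∧ ¬ c (.inr s) := by
    revert s
    decide +kernel
  have hdeg : IsNearTwoFactor H (.inl (4 + s)) (.inr (6 + s)) ∧ H.degree (.inl (4 + s)) = 3 := by
    revert s
    decide +kernel
  refine ⟨H, SimpleGraph.deleteEdges_le _,
    not_connected_of_coloring (c := fun v => c v) hc.1 hc.2.1 hc.2.2, hdeg.1, ?_⟩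
  rw [deg_eq_degree, hdeg.2]

end Heawood

section FbarOn

variable {J U : Type*} {P : Fin 3 → J ⊕ U → Bool} {Q : J → Fin 3 → Fin 2 → Bool}

/-- The vertices of a `K_{3,3}` in which the elements `J` of one colour class have been replaced by
copies of `K_{2,3}` and the elements `U` have not: the other colour class, then the leaves
`(j, inl i)` and hubs `(j, inr c)` of the copies of `K_{2,3}`, then `U`. Below, the elements of the
other colour class are called class vertices, those of `U` single vertices, and those of `J ⊕ U`
slots. -/
abbrev FbarVertex (J U : Type*) : Type _ := Fin 3 ⊕ (J × (Fin 3 ⊕ Fin 2)) ⊕ U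

/-- The edges of `fbarSub P Q`, each in one direction. -/
def fbarRel (P : Fin 3 → J ⊕ U → Bool) (Q : J → Fin 3 → Fin 2 → Bool) :
    FbarVertex J U → FbarVertex J U → Prop
  | .inl i, .inr (.inl (j, .inl i')) => i = i' ∧ P i (.inl j)
  | .inl i, .inr (.inr s) => P i (.inr s)
  | .inr (.inl (j, .inl i)), .inr (.inl (j', .inr c)) => j = j' ∧ Q j i c
  | _, _ => False

/-- The spanning subgraph of `fbarOn J U` with the edges between the class vertex `i` and the slot
`s` for which `P i s`, and the edges between the leaf `i` and the hub `c` of the copy `j` of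
`K_{2,3}` for which `Q j i c`. -/
def fbarSub (P : Fin 3 → J ⊕ U → Bool) (Q : J → Fin 3 → Fin 2 → Bool) :
    SimpleGraph (FbarVertex J U) :=
  SimpleGraph.fromRel (fbarRel P Q)

/-- The graph `Fbar k` for arbitrary index types `J` of replaced and `U` of kept vertices. -/
def fbarOn (J U : Type*) : SimpleGraph (FbarVertex J U) :=
  fbarSub (fun _ _ => true) fun _ _ _ => true

instance [DecidableEq J] : DecidableRel (fbarRel P Q)
  | .inl i, .inr (.inl (j, .inl i')) => inferInstanceAs (Decidable (i = i' ∧ P i (.inl j)))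
  | .inl i, .inr (.inr s) => inferInstanceAs (Decidable (P i (.inr s)))
  | .inr (.inl (j, .inl i)), .inr (.inl (j', .inr c)) =>
    inferInstanceAs (Decidable (j = j' ∧ Q j i c))
  | .inl _, .inl _ | .inl _, .inr (.inl (_, .inr _)) | .inr (.inl (_, .inr _)), _
  | .inr (.inl (_, .inl _)), .inl _ | .inr (.inl (_, .inl _)), .inr (.inl (_, .inl _))
  | .inr (.inl (_, .inl _)), .inr (.inr _) | .inr (.inr _), _ => inferInstanceAs (Decidable False)

instance [DecidableEq J] [DecidableEq U] : DecidableRel (fbarSub P Q).Adj :=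
  inferInstanceAs (DecidableRel (SimpleGraph.fromRel (fbarRel P Q)).Adj)

theorem fbarSub_adj {v w : FbarVertex J U} :
    (fbarSub P Q).Adj v w ↔ fbarRel P Q v w ∨ fbarRel P Q w v := by
  rw [fbarSub, SimpleGraph.fromRel_adj, and_iff_right_iff_imp]
  rintro h rfl
  rcases v with i | ⟨j, i | c⟩ | s <;> simp [fbarRel] at h

theorem fbarSub_le : fbarSub P Q ≤ fbarOn J U := by
  rintro (i | ⟨j, i | c⟩ | s) (i' | ⟨j', i' | c'⟩ | s') <;>
    simp +contextual [fbarOn, fbarSub_adj, fbarRel]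

theorem fbarOn_adj {v w : FbarVertex J U} : (fbarOn J U).Adj v w ↔
    fbarRel (fun _ _ => true) (fun _ _ _ => true) v w ∨
      fbarRel (fun _ _ => true) (fun _ _ _ => true) w v :=
  fbarSub_adj

theorem fbar_eq_fbarOn (k : Fin 4) : Fbar k = fbarOn (Fin k) (Fin (3 - k)) := by
  ext (i | ⟨j, i | c⟩ | s) (i' | ⟨j', i' | c'⟩ | s') <;> simp [Fbar, fbarOn_adj, fbarRel]

/-- The vertex by which the slot `s` is joined to the class vertex `i`. -/
def port (i : Fin 3) : J ⊕ U → FbarVertex J U :=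
  Sum.elim (fun j => .inr (.inl (j, .inl i))) fun s => .inr (.inr s)

end FbarOn

section DisconnectedNearTwoFactors

/-- `H` is a near `2`-factor with root `a` of odd degree that is disconnected because no edge joins
the two nonempty colour classes of `col`. Unlike `HasDisconnectedNearTwoFactor`, this is decidable
by enumeration. -/
def IsSplitNearTwoFactor {V : Type*} (H : SimpleGraph V) (a c : V) (col : V → Bool) : Prop :=
  IsNearTwoFactor H a c ∧ Odd (deg H a) ∧ (∀ v w, H.Adj v w → (col v ↔ col w)) ∧
    (∃ v, col v) ∧ ∃ w, ¬ col w

variable {V : Type*} {G H : SimpleGraph V} {a c : V} {col : V → Bool}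

instance [Fintype V] [DecidableEq V] [DecidableRel H.Adj] :
    Decidable (IsSplitNearTwoFactor H a c col) :=
  decidable_of_iff (IsNearTwoFactor H a c ∧ Odd (H.degree a) ∧
    (∀ v w, H.Adj v w → (col v ↔ col w)) ∧ (∃ v, col v) ∧ ∃ w, ¬ col w)
    (by rw [IsSplitNearTwoFactor, deg_eq_degree])

theorem IsSplitNearTwoFactor.hasDisconnectedNearTwoFactor (h : IsSplitNearTwoFactor H a c col)
    (hle : H ≤ G) : HasDisconnectedNearTwoFactor G a := by
  obtain ⟨hH, hodd, hcol, ⟨v, hv⟩, w, hw⟩ := h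
  exact ⟨H, hle, not_connected_of_coloring (c := fun v => col v) hcol hv hw, hodd, c, hH⟩

instance {J U : Type*} [Fintype J] [Fintype U] [DecidableEq J] [DecidableEq U]
    {P : Fin 3 → J ⊕ U → Bool} {Q : J → Fin 3 → Fin 2 → Bool} {a c : FbarVertex J U}
    {col : FbarVertex J U → Bool} : Decidable (IsSplitNearTwoFactor (fbarSub P Q) a c col) :=
  inferInstance

theorem hasDisconnectedNearTwoFactor_class (k : Fin 4) (j : Fin k) (i : Fin 3) :
    HasDisconnectedNearTwoFactor (fbarOn (Fin k) (Fin (3 - k))) (.inl i) := by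
  -- `(i' - i).val + c.val ≠ 2` cuts a copy of `K_{2,3}` down to the path that starts at the leaf
  -- `i + 1`, passes through the leaf `i` and ends at the leaf `i + 2`.
  refine IsSplitNearTwoFactor.hasDisconnectedNearTwoFactor (H := fbarSub
      (fun i' s => if s = .inl j then i' = i else i' ≠ i)
      fun j' i' c => if j' = j then ¬ (i' = i ∧ c = 1) else (i' - i).val + c.val ≠ 2)
    (c := .inr (.inl (j, .inr 0)))
    (col := Sum.elim (fun i' => i' = i) (Sum.elim (fun p => p.1 = j) fun _ => false))
    ?_ fbarSub_le
  revert k j i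
  decide +kernel

theorem hasDisconnectedNearTwoFactor_leaf (k : Fin 4) (j : Fin k) (i : Fin 3) :
    HasDisconnectedNearTwoFactor (fbarOn (Fin k) (Fin (3 - k))) (.inr (.inl (j, .inl i))) := by
  obtain ⟨t, ht⟩ : ∃ t : Fin k ⊕ Fin (3 - k), t ≠ .inl j := by
    revert k j
    decide
  refine IsSplitNearTwoFactor.hasDisconnectedNearTwoFactor (H := fbarSub
      (fun i' s => if s = .inl j then i' = i else if s = t then true else i' ≠ i)
      fun j' i' c => if j' = j then i' ≠ i else (i' - i).val + c.val ≠ 2)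
    (c := port i t)
    (col := Sum.elim (fun _ => false)
      (Sum.elim (fun p => p.1 = j ∧ p.2 ≠ .inl i) fun _ => false))
    ?_ fbarSub_le
  revert k j i t
  decide +kernel

theorem hasDisconnectedNearTwoFactor_hub (k : Fin 4) (j j' : Fin k) (hj : j ≠ j') (c : Fin 2) :
    HasDisconnectedNearTwoFactor (fbarOn (Fin k) (Fin (3 - k))) (.inr (.inl (j, .inr c))) := by
  refine IsSplitNearTwoFactor.hasDisconnectedNearTwoFactor (H := fbarSub
      (fun i s => if s = .inl j then true else if s = .inl j' then i = 0 else i ≠ 0)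
      fun j'' i c' => if j'' = j then (c' = c ↔ i = 0)
        else if j'' = j' then ¬ (i = 0 ∧ c' = 1) else i.val + c'.val ≠ 2)
    (c := .inr (.inl (j', .inr 0)))
    (col := Sum.elim (fun i => i = 0) (Sum.elim
      (fun p => if p.1 = j then p.2 = .inl 0 ∨ p.2 = .inr c else p.1 = j') fun _ => false))
    ?_ fbarSub_le
  revert k j j' c
  decide +kernel

end DisconnectedNearTwoFactors

section Isomorphisms

variable {J J' U U' : Type*}

/-- `fbarOn J U` depends only on the index types up to equivalence. -/
def fbarOnCongr (f : J ≃ J') (g : U ≃ U') : fbarOn J U ≃g fbarOn J' U' where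
  toEquiv := Equiv.sumCongr (Equiv.refl _) (Equiv.sumCongr (Equiv.prodCongr f (Equiv.refl _)) g)
  map_rel_iff' := by
    rintro (i | ⟨j, i | c⟩ | s) (i' | ⟨j', i' | c'⟩ | s') <;> simp [fbarOn_adj, fbarRel]

/-- Without replaced vertices, `fbarOn J U` is a complete bipartite graph. -/
def fbarOnOfIsEmpty [IsEmpty J] : fbarOn J U ≃g completeBipartiteGraph (Fin 3) U where
  toEquiv := Equiv.sumCongr (Equiv.refl _) (Equiv.emptySum _ _)
  map_rel_iff' := by
    have hJ (p : J × (Fin 3 ⊕ Fin 2)) : False := isEmptyElim p.1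
    rintro (i | p | s) (i' | p' | s') <;>
      first | exact (hJ p).elim | exact (hJ p').elim | simp [fbarOn_adj, fbarRel]

theorem nonempty_fbar_zero_iso_K33 : Nonempty (Fbar 0 ≃g K33) :=
  have : IsEmpty (Fin (0 : Fin 4)) := inferInstanceAs (IsEmpty (Fin 0))
  ⟨fbar_eq_fbarOn 0 ▸ fbarOnOfIsEmpty⟩

theorem neighborSet_fbarOn_single (s : U) :
    (fbarOn J U).neighborSet (.inr (.inr s)) = Set.range Sum.inl := by
  ext (i | ⟨j, i | c⟩ | s') <;> simp [fbarOn_adj, fbarRel]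

/-- The neighbours of a vertex that is not replaced are the vertices of the other colour class. -/
noncomputable def classEquivNeighborSet (J : Type*) (s : U) :
    Fin 3 ≃ (fbarOn J U).neighborSet (.inr (.inr s)) :=
  (Equiv.ofInjective _ Sum.inl_injective).trans (Equiv.setCongr (neighborSet_fbarOn_single s).symm)

theorem K33_adj_iff_not_iff {b x y : Fin 3 ⊕ Fin 3} :
    K33.Adj x y ↔ ¬ (K33.Adj b x ↔ K33.Adj b y) := by
  rcases b with b | b <;> rcases x with x | x <;> rcases y with y | y <;> simp

theorem exists_iso_K33_comap_ne (b : Fin 3 ⊕ Fin 3) (τ : Fin 3 ≃ K33.neighborSet b) :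
    ∃ g : completeBipartiteGraph (Fin 3) (Fin 2) ≃g
      K33.comap (Subtype.val : {y // y ≠ b} → Fin 3 ⊕ Fin 3),
      ∀ i, (g (.inl i) : Fin 3 ⊕ Fin 3) = τ i := by
  let left : Fin 3 ≃ {y : {y // y ≠ b} // K33.Adj b y} :=
    τ.trans (Equiv.subtypeSubtypeEquivSubtype fun (h : K33.Adj b _) => h.ne').symm
  let right : Fin 2 ≃ {y : {y // y ≠ b} // ¬ K33.Adj b y} :=
    (Fintype.equivFinOfCardEq (by clear τ left; revert b; decide)).symm
  let g : Fin 3 ⊕ Fin 2 ≃ {y // y ≠ b} := (Equiv.sumCongr left right).trans (Equiv.sumCompl _)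
  have hg (p : Fin 3 ⊕ Fin 2) : K33.Adj b (g p) ↔ p.isLeft := by
    rcases p with i | c
    · exact iff_of_true (left i).2 rfl
    · exact iff_of_false (right c).2 (by simp)
  refine ⟨⟨g, fun {p q} => ?_⟩, fun i => rfl⟩
  rw [SimpleGraph.comap_adj, K33_adj_iff_not_iff (b := b), hg, hg]
  rcases p with i | c <;> rcases q with i' | c' <;> simp

/-- The vertices of the star product of `fbarOn J U` with `K33` at the vertex `s` that is not
replaced, when `g` labels the vertices of the new copy of `K_{2,3}`. -/
def fbarVertexOptionEquiv {W : Type*} (s : U) (g : Fin 3 ⊕ Fin 2 ≃ W) :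
    FbarVertex (Option J) {s' : U // s' ≠ s} ≃
      {x : FbarVertex J U // x ≠ .inr (.inr s)} ⊕ W where
  toFun
    | .inl i => .inl ⟨.inl i, by simp⟩
    | .inr (.inl (some j, p)) => .inl ⟨.inr (.inl (j, p)), by simp⟩
    | .inr (.inl (none, p)) => .inr (g p)
    | .inr (.inr s') => .inl ⟨.inr (.inr s'), by simpa using s'.2⟩
  invFun
    | .inl ⟨.inl i, _⟩ => .inl i
    | .inl ⟨.inr (.inl (j, p)), _⟩ => .inr (.inl (some j, p))
    | .inl ⟨.inr (.inr s'), h⟩ => .inr (.inr ⟨s', by simpa using h⟩)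
    | .inr q => .inr (.inl (none, g.symm q))
  left_inv := by rintro (i | ⟨j | j, p⟩ | s') <;> simp
  right_inv := by rintro (⟨i | ⟨j, p⟩ | s', h⟩ | q) <;> simp

theorem starProduct_fbarOn_adj_inl_inr {s : U} {b : Fin 3 ⊕ Fin 3}
    (σ : (fbarOn J U).neighborSet (.inr (.inr s)) ≃ K33.neighborSet b)
    {g : Fin 3 ⊕ Fin 2 ≃ {y // y ≠ b}}
    (hg : ∀ i, (g (.inl i) : Fin 3 ⊕ Fin 3) = σ (classEquivNeighborSet J s i))
    (x : {x : FbarVertex J U // x ≠ .inr (.inr s)}) (p : Fin 3 ⊕ Fin 2) :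
    (starProduct (fbarOn J U) K33 (.inr (.inr s)) b σ).Adj (.inl x) (.inr (g p)) ↔
      ∃ i, x.1 = .inl i ∧ p = .inl i := by
  rw [starProduct_adj_inl_inr]
  constructor
  · rintro ⟨h, e⟩
    obtain ⟨i, hi⟩ := (classEquivNeighborSet J s).surjective ⟨x, h⟩
    refine ⟨i, congrArg Subtype.val hi.symm, g.injective (Subtype.ext ?_)⟩
    rw [hg, hi, e]
  · obtain ⟨x, hx⟩ := x
    rintro ⟨i, rfl, rfl⟩
    exact ⟨(classEquivNeighborSet J s i).2, (hg i).symm⟩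

theorem nonempty_starProduct_fbarOn_iso (s : U) (b : Fin 3 ⊕ Fin 3)
    (σ : (fbarOn J U).neighborSet (.inr (.inr s)) ≃ K33.neighborSet b) :
    Nonempty (starProduct (fbarOn J U) K33 (.inr (.inr s)) b σ ≃g
      fbarOn (Option J) {s' : U // s' ≠ s}) := by
  obtain ⟨g, hg⟩ := exists_iso_K33_comap_ne b ((classEquivNeighborSet J s).trans σ)
  have hcut := starProduct_fbarOn_adj_inl_inr σ (g := g.toEquiv) hg
  have hcut' (x : {x : FbarVertex J U // x ≠ .inr (.inr s)}) (p : Fin 3 ⊕ Fin 2) :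
      (starProduct (fbarOn J U) K33 (.inr (.inr s)) b σ).Adj (.inr (g.toEquiv p)) (.inl x) ↔ _ :=
    (SimpleGraph.adj_comm _ _ _).trans (hcut x p)
  have hadj (p q : Fin 3 ⊕ Fin 2) : K33.Adj (g.toEquiv p) (g.toEquiv q) ↔
      (completeBipartiteGraph (Fin 3) (Fin 2)).Adj p q := g.map_adj_iff
  generalize g.toEquiv = g at *
  refine ⟨SimpleGraph.Iso.symm ⟨fbarVertexOptionEquiv s g, fun {v w} => ?_⟩⟩
  rcases v with i | ⟨_ | j, i | c⟩ | t <;> rcases w with i' | ⟨_ | j', i' | c'⟩ | t' <;>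
    simp [-starProduct_adj_inl_inr, -starProduct_adj_inr_inl, -completeBipartiteGraph_adj,
      fbarVertexOptionEquiv, hcut, hcut', hadj, fbarOn_adj, fbarRel, eq_comm] <;> simp

end Isomorphisms

section StarProductWithK33

variable {J U : Type*}

theorem exists_iso_fbarOn_class_eq_single [IsEmpty J] (i : Fin 3) :
    ∃ e : fbarOn J (Fin 3) ≃g fbarOn J (Fin 3), ∃ s, e (.inl i) = .inr (.inr s) := by
  let swap : K33 ≃g K33 := ⟨Equiv.sumComm _ _, by rintro (i | i) (j | j) <;> simp⟩
  exact ⟨(fbarOnOfIsEmpty.trans swap).trans fbarOnOfIsEmpty.symm, i, rfl⟩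

/-- The exchange of the two copies of `K_{2,3}` in `fbarOn J (Fin 2)`, when `J` has one element: the
class and single vertices form the second copy. -/
def fbarOnSwap [Unique J] : fbarOn J (Fin 2) ≃g fbarOn J (Fin 2) where
  toFun
    | .inl i => .inr (.inl (default, .inl i))
    | .inr (.inl (_, .inl i)) => .inl i
    | .inr (.inl (_, .inr c)) => .inr (.inr c)
    | .inr (.inr c) => .inr (.inl (default, .inr c))
  invFun
    | .inl i => .inr (.inl (default, .inl i))
    | .inr (.inl (_, .inl i)) => .inl i
    | .inr (.inl (_, .inr c)) => .inr (.inr c)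
    | .inr (.inr c) => .inr (.inl (default, .inr c))
  left_inv := by rintro (i | ⟨j, i | c⟩ | s) <;> simp [Unique.eq_default]
  right_inv := by rintro (i | ⟨j, i | c⟩ | s) <;> simp [Unique.eq_default]
  map_rel_iff' := by
    rintro (i | ⟨j, i | c⟩ | s) (i' | ⟨j', i' | c'⟩ | s') <;>
      simp [fbarOn_adj, fbarRel, eq_comm, Unique.eq_default]

theorem hasDisconnectedNearTwoFactor_or_exists_iso (k : Fin 4)
    (v : FbarVertex (Fin k) (Fin (3 - k))) :
    HasDisconnectedNearTwoFactor (fbarOn (Fin k) (Fin (3 - k))) v ∨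
      ∃ e : fbarOn (Fin k) (Fin (3 - k)) ≃g fbarOn (Fin k) (Fin (3 - k)),
        ∃ s, e v = .inr (.inr s) := by
  rcases v with i | ⟨j, i | c⟩ | s
  · rcases eq_or_ne k 0 with rfl | hk
    · have : IsEmpty (Fin (0 : Fin 4)) := inferInstanceAs (IsEmpty (Fin 0))
      exact .inr (exists_iso_fbarOn_class_eq_single i)
    · exact .inl (hasDisconnectedNearTwoFactor_class k ⟨0, Fin.pos_iff_ne_zero.2 hk⟩ i)
  · exact .inl (hasDisconnectedNearTwoFactor_leaf k j i)
  · rcases eq_or_ne k 1 with rfl | hk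
    · let : Unique (Fin (1 : Fin 4)) := inferInstanceAs (Unique (Fin 1))
      exact .inr ⟨fbarOnSwap, c, rfl⟩
    · obtain ⟨j', hj⟩ : ∃ j', j ≠ j' := by
        revert k
        decide
      exact .inl (hasDisconnectedNearTwoFactor_hub k j j' hj c)
  · exact .inr ⟨SimpleGraph.Iso.refl, s, rfl⟩

variable {V : Type*} {G : SimpleGraph V} {a : V} {b : Fin 3 ⊕ Fin 3} {k : Fin 4}

theorem exists_nonempty_starProduct_iso_fbar_succ (e : G ≃g fbarOn (Fin k) (Fin (3 - k)))
    {s : Fin (3 - k)} (hs : e a = .inr (.inr s)) (σ : G.neighborSet a ≃ K33.neighborSet b) :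
    ∃ k' : Fin 4, (k' : ℕ) = k + 1 ∧ Nonempty (starProduct G K33 a b σ ≃g Fbar k') := by
  have hk : (k : ℕ) + 1 < 4 := by
    have := s.isLt
    omega
  refine ⟨⟨k + 1, hk⟩, rfl, ?_⟩
  have f := starProductCongrLeft e a b σ
  generalize (e.mapNeighborSet a).symm.trans σ = σ' at f
  generalize e a = v at hs σ' f
  subst hs
  obtain ⟨g⟩ := nonempty_starProduct_fbarOn_iso s b σ'
  rw [fbar_eq_fbarOn]
  refine ⟨(f.trans g).trans (fbarOnCongr (Fintype.equivOfCardEq ?_) (Fintype.equivOfCardEq ?_))⟩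
  · simp
  · simp [Nat.sub_sub]

theorem exists_isAlmostTwoFactor_or_iso_fbar_starProduct_K33 (e : G ≃g Fbar k)
    (σ : G.neighborSet a ≃ K33.neighborSet b) :
    (∃ H, IsAlmostTwoFactor (starProduct G K33 a b σ) H) ∨
      ∃ k', Nonempty (starProduct G K33 a b σ ≃g Fbar k') := by
  rw [fbar_eq_fbarOn] at e
  obtain h | ⟨f, s, hs⟩ := hasDisconnectedNearTwoFactor_or_exists_iso k (e a)
  · have : Nontrivial (Fin 3 ⊕ Fin 3) := ⟨.inl 0, .inr 0, Sum.inl_ne_inr⟩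
    exact .inl (exists_isAlmostTwoFactor_starProduct (h.of_iso e)
      fun _ hT => exists_isNearTwoFactor_K33 hT)
  · obtain ⟨k', -, hk'⟩ := exists_nonempty_starProduct_iso_fbar_succ (e.trans f) hs σ
    exact .inr ⟨k', hk'⟩

end StarProductWithK33

section Matchings

variable {V : Type*} {G H : SimpleGraph V} {M : G.Subgraph}

theorem connected_iff_card_connectedComponent_eq_one :
    G.Connected ↔ Nat.card G.ConnectedComponent = 1 := by
  rw [Nat.card_eq_one_iff_unique, SimpleGraph.connected_iff]
  refine and_congr ⟨fun h => h.subsingleton_connectedComponent, fun h v w => ?_⟩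
    ⟨fun h => h.map G.connectedComponentMk, fun h => h.elim fun c => c.nonempty_supp.to_type⟩
  exact SimpleGraph.ConnectedComponent.exact (Subsingleton.elim _ _)

theorem isSeparatingMatching_iff_not_connected [Finite V] (hG : G.Connected) :
    IsSeparatingMatching G M ↔ M.IsMatching ∧ ¬ (G.deleteEdges M.edgeSet).Connected := by
  have := hG.nonempty
  have : Nonempty (G.deleteEdges M.edgeSet).ConnectedComponent :=
    this.map (SimpleGraph.connectedComponentMk _)
  have hpos := Nat.card_pos (α := (G.deleteEdges M.edgeSet).ConnectedComponent)
  rw [connected_iff_card_connectedComponent_eq_one] at hG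
  rw [IsSeparatingMatching, connected_iff_card_connectedComponent_eq_one, hG,
    (Nat.succ_le_of_lt hpos).lt_iff_ne']

theorem ncard_edgeSet_le_mms [Finite V] (hM : IsSeparatingMatching G M) : M.edgeSet.ncard ≤ mms G :=
  le_csSup ⟨Nat.card (Sym2 V), by
    rintro _ ⟨M, -, rfl⟩
    exact Set.ncard_le_card _⟩ ⟨M, hM, rfl⟩

theorem ncard_verts_eq_two_mul_ncard_edgeSet [Finite V] (hM : M.IsMatching) :
    M.verts.ncard = 2 * M.edgeSet.ncard := by
  classical
  have := Fintype.ofFinite V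
  have hdeg (v : V) : M.spanningCoe.degree v = if v ∈ M.verts then 1 else 0 := by
    rw [SimpleGraph.Subgraph.degree_spanningCoe]
    split_ifs with hv
    · exact SimpleGraph.Subgraph.isMatching_iff_forall_degree.1 hM v hv
    · exact SimpleGraph.Subgraph.degree_of_notMem_verts hv
  have hsum := M.spanningCoe.sum_degrees_eq_twice_card_edges
  simp only [hdeg, Finset.sum_boole, Nat.cast_id] at hsum
  rw [← M.edgeSet_spanningCoe, ← SimpleGraph.coe_edgeFinset, Set.ncard_coe_finset, ← hsum,
    ← Set.ncard_coe_finset]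
  simp

theorem ncard_edgeSet_le_ncard_of_isVertexCover [Finite V] (hM : M.IsMatching) {S : Set V}
    (hS : M.spanningCoe.IsVertexCover S) : M.edgeSet.ncard ≤ S.ncard := by
  have hcover (e : M.edgeSet) : ∃ v : S, ∃ w, M.Adj v w ∧ e.1 = s(v.1, w) := by
    obtain ⟨⟨v, w⟩, h⟩ := e
    obtain hv | hw := hS h
    · exact ⟨⟨v, hv⟩, w, h, rfl⟩
    · exact ⟨⟨w, hw⟩, v, h.symm, Sym2.eq_swap⟩
  choose f g hadj hfg using hcover
  refine Nat.card_le_card_of_injective f fun e e' hee' => Subtype.ext ?_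
  have hadj' : M.Adj (f e) (g e') := hee' ▸ hadj e'
  rw [hfg e, hfg e', ← hee', hM.eq_of_adj_left (hadj e) hadj']

/-- The edges of `G` outside of `H`, as a subgraph of `G` without isolated vertices. -/
def complementSubgraph (G H : SimpleGraph V) : G.Subgraph where
  verts := (G \ H).support
  Adj := (G \ H).Adj
  adj_sub h := h.1
  edge_vert h := ⟨_, h⟩
  symm := (G \ H).symm

theorem deleteEdges_complementSubgraph (h : H ≤ G) :
    G.deleteEdges (complementSubgraph G H).edgeSet = H := by
  ext v w
  rw [SimpleGraph.deleteEdges_adj, SimpleGraph.Subgraph.mem_edgeSet]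
  exact ⟨fun ⟨hG, hn⟩ => by_contra fun hH => hn ⟨hG, hH⟩, fun hH => ⟨h hH, fun hn => hn.2 hH⟩⟩

section NearTwoFactor

variable {p q : V}

theorem deg_sdiff [Finite V] (hle : H ≤ G) (v : V) : deg (G \ H) v = deg G v - deg H v :=
  Set.ncard_sdiff fun _ hw => hle hw

theorem verts_complementSubgraph [Finite V] (hG : IsRegular G 3) (hle : H ≤ G)
    (hH : IsNearTwoFactor H p q) (hp : deg H p = 3) :
    (complementSubgraph G H).verts = {p, q}ᶜ := by
  ext v
  have hsupp : v ∈ (complementSubgraph G H).verts ↔ deg (G \ H) v ≠ 0 := by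
    rw [← Nat.pos_iff_ne_zero, Set.ncard_pos]
    rfl
  rw [hsupp, deg_sdiff hle, hG v, Set.mem_compl_iff, not_iff_not, Set.mem_insert_iff,
    Set.mem_singleton_iff]
  constructor
  · intro h
    by_contra! hv
    rw [hH.2.2 v hv.1 hv.2] at h
    contradiction
  · rintro (rfl | rfl)
    · rw [hp]
    · rw [hH.2.1]

theorem isMatching_complementSubgraph [Finite V] (hG : IsRegular G 3) (hle : H ≤ G)
    (hH : IsNearTwoFactor H p q) (hp : deg H p = 3) : (complementSubgraph G H).IsMatching := by
  intro v hv
  rw [verts_complementSubgraph hG hle hH hp, Set.mem_compl_iff, Set.mem_insert_iff,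
    Set.mem_singleton_iff, not_or] at hv
  have hdeg : deg (G \ H) v = 1 := by rw [deg_sdiff hle, hG v, hH.2.2 v hv.1 hv.2]
  obtain ⟨w, hw⟩ := Set.ncard_eq_one.1 hdeg
  exact ⟨w, hw.ge rfl, fun _ hy => hw.le hy⟩

theorem card_eq_of_isNearTwoFactor [Finite V] (hG : IsRegular G 3) (hle : H ≤ G)
    (hH : IsNearTwoFactor H p q) (hp : deg H p = 3) :
    Nat.card V = 2 * (complementSubgraph G H).edgeSet.ncard + 2 := by
  rw [← ncard_verts_eq_two_mul_ncard_edgeSet (isMatching_complementSubgraph hG hle hH hp),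
    verts_complementSubgraph hG hle hH hp, ← Set.ncard_pair hH.1, Set.ncard_compl_add_ncard]

end NearTwoFactor

theorem card_le_two_mul_mms_add_two [Finite V] (hG : IsRegular G 3) (hc : G.Connected)
    (hH : IsAlmostTwoFactor G H) : Nat.card V ≤ 2 * mms G + 2 := by
  obtain ⟨hle, hdis, p, q, hpq, hp⟩ := isAlmostTwoFactor_iff.1 hH
  have hM := ncard_edgeSet_le_mms <| (isSeparatingMatching_iff_not_connected hc).2
    ⟨isMatching_complementSubgraph hG hle hpq hp, by rwa [deleteEdges_complementSubgraph hle]⟩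
  rw [card_eq_of_isNearTwoFactor hG hle hpq hp]
  omega

section Isomorphism

variable {W : Type*} {G' : SimpleGraph W}

/-- An isomorphism of graphs remains one after deleting corresponding edges. -/
def deleteEdgesIso (e : G ≃g G') (M : G.Subgraph) :
    G.deleteEdges M.edgeSet ≃g G'.deleteEdges (M.map e.toHom).edgeSet where
  toEquiv := e.toEquiv
  map_rel_iff' {v w} := by
    rw [SimpleGraph.deleteEdges_adj, SimpleGraph.deleteEdges_adj,
      SimpleGraph.Subgraph.edgeSet_map]
    exact and_congr e.map_adj_iff (not_congr
      ((Sym2.map.injective e.injective).mem_set_image (s := M.edgeSet) (a := s(v, w))))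

theorem IsSeparatingMatching.map (e : G ≃g G') (hM : IsSeparatingMatching G M) :
    IsSeparatingMatching G' (M.map e.toHom) := by
  refine ⟨hM.1.map e.toHom e.injective, ?_⟩
  rw [← Nat.card_congr e.connectedComponentEquiv,
    ← Nat.card_congr (deleteEdgesIso e M).connectedComponentEquiv]
  exact hM.2

theorem ncard_edgeSet_map (e : G ≃g G') : (M.map e.toHom).edgeSet.ncard = M.edgeSet.ncard := by
  rw [SimpleGraph.Subgraph.edgeSet_map]
  exact Set.ncard_image_of_injective _ (Sym2.map.injective e.injective)

theorem mms_congr (e : G ≃g G') : mms G = mms G' := by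
  refine congrArg sSup (Set.ext fun n => ⟨?_, ?_⟩)
  · rintro ⟨M, hM, rfl⟩
    exact ⟨_, hM.map e, ncard_edgeSet_map e⟩
  · rintro ⟨M, hM, rfl⟩
    exact ⟨_, hM.map e.symm, ncard_edgeSet_map e.symm⟩

end Isomorphism

end Matchings

section MatchingsOfFbarOn

variable {J U : Type*} {M : (fbarOn J U).Subgraph}

/- A complete bipartite graph minus the matching `m` is connected because two vertices on the left
have a common neighbour when there are more than two vertices on the right. -/
theorem iff_of_forall_not_rel_iff {α β : Type*} [Fintype β] (hβ : 2 < Fintype.card β)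
    {m : α → β → Prop} (hm : ∀ a b b', m a b → m a b' → b = b') (hm' : ∀ b, ∃ a, ¬ m a b)
    {c : α → Prop} {d : β → Prop} (hcd : ∀ a b, ¬ m a b → (c a ↔ d b)) (a : α) (b : β) :
    c a ↔ d b := by
  obtain ⟨a', ha'⟩ := hm' b
  obtain ⟨b', h, h'⟩ : ∃ b', ¬ m a b' ∧ ¬ m a' b' := by
    by_contra! h
    obtain ⟨x, y, hxy, heq⟩ :=
      Fintype.exists_ne_map_eq_of_card_lt (m a) (by rwa [Fintype.card_prop])
    by_cases hx : m a x
    · exact hxy (hm a x y hx (heq ▸ hx))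
    · exact hxy (hm a' x y (h x hx) (h y (heq ▸ hx)))
  rw [hcd a b' h, ← hcd a' b' h', hcd a' b ha']

theorem port_injective (i : Fin 3) :
    Function.Injective (port i : J ⊕ U → FbarVertex J U) := by
  rintro (j | s) (j' | s') <;> simp [port]

theorem exists_adj_hub [Fintype J] [Finite U] (hM : M.IsMatching)
    (hcard : 2 * Fintype.card J + 2 ≤ M.edgeSet.ncard) (j : J) :
    ∃ i c, M.Adj (.inr (.inl (j, .inl i))) (.inr (.inl (j, .inr c))) := by
  by_contra! h
  classical
  let hub (p : {j' // j' ≠ j} × Fin 2) : FbarVertex J U := .inr (.inl (p.1, .inr p.2))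
  let cover : Set (FbarVertex J U) := Set.range .inl ∪ Set.range hub
  have hrel (v w : FbarVertex J U) (hvw : M.Adj v w)
      (h' : fbarRel (fun _ _ => true) (fun _ _ _ => true) v w) : v ∈ cover ∨ w ∈ cover := by
    rcases v with i | ⟨j', i | c⟩ | s
    · exact .inl (.inl ⟨i, rfl⟩)
    · rcases w with _ | ⟨j'', _ | c⟩ | _
      any_goals exact h'.elim
      obtain rfl : j' = j'' := h'.1
      exact .inr (.inr ⟨(⟨j', by rintro rfl; exact h i c hvw⟩, c), rfl⟩)
    · exact h'.elim
    · exact h'.elim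
  have hcover : M.spanningCoe.IsVertexCover cover := fun v w hvw =>
    (fbarOn_adj.1 (M.adj_sub hvw)).elim (hrel v w hvw) fun h => (hrel w v hvw.symm h).symm
  have hle := (ncard_edgeSet_le_ncard_of_isVertexCover hM hcover).trans
    ((Set.ncard_union_le _ _).trans (add_le_add (Finite.card_range_le _) (Finite.card_range_le _)))
  have hpos : 0 < Fintype.card J := Fintype.card_pos_iff.2 ⟨j⟩
  simp only [Nat.card_eq_fintype_card, Fintype.card_fin, Fintype.card_prod,
    ne_eq, Fintype.card_subtype_compl, Fintype.card_unique] at hle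
  omega

variable {col : FbarVertex J U → Prop}

theorem color_leaf_iff_color_hub (hM : M.IsMatching)
    (hcol : ∀ v w, ((fbarOn J U).deleteEdges M.edgeSet).Adj v w → (col v ↔ col w))
    (j : J) (i : Fin 3) (c : Fin 2) :
    col (.inr (.inl (j, .inl i))) ↔ col (.inr (.inl (j, .inr c))) := by
  refine (iff_of_forall_not_rel_iff (by decide)
    (m := fun c i => M.Adj (.inr (.inl (j, .inl i))) (.inr (.inl (j, .inr c))))
    (c := fun c => col (.inr (.inl (j, .inr c)))) (d := fun i => col (.inr (.inl (j, .inl i))))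
    (fun c i i' h h' => ?_) (fun i => ?_) (fun c i h => ?_) c i).symm
  · simpa using hM.eq_of_adj_right h h'
  · by_contra! h
    simpa using hM.eq_of_adj_left (h 0) (h 1)
  · exact (hcol _ _ ((SimpleGraph.deleteEdges_adj ..).2 ⟨by simp [fbarOn_adj, fbarRel], h⟩)).symm

theorem color_class_iff_color_port [Fintype J] [Fintype U] (hJU : 2 < Fintype.card (J ⊕ U))
    (hM : M.IsMatching) (hcard : 2 * Fintype.card J + 2 ≤ M.edgeSet.ncard)
    (hcol : ∀ v w, ((fbarOn J U).deleteEdges M.edgeSet).Adj v w → (col v ↔ col w))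
    (i i' : Fin 3) (s : J ⊕ U) : col (.inl i) ↔ col (port i' s) := by
  have hport (i i' : Fin 3) (s : J ⊕ U) : col (port i s) ↔ col (port i' s) := by
    rcases s with j | s
    · exact (color_leaf_iff_color_hub hM hcol j i 0).trans
        (color_leaf_iff_color_hub hM hcol j i' 0).symm
    · rfl
  refine iff_of_forall_not_rel_iff hJU
    (m := fun i s => M.Adj (.inl i) (port i s))
    (c := fun i => col (.inl i)) (d := fun s => col (port i' s))
    (fun i s s' h h' => ?_) (fun s => ?_) (fun i s h => ?_) i s
  · exact port_injective i (hM.eq_of_adj_left h h')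
  · rcases s with j | s
    · obtain ⟨i, c, h⟩ := exists_adj_hub hM hcard j
      refine ⟨i, fun h' => ?_⟩
      simpa using hM.eq_of_adj_left h h'.symm
    · by_contra! h
      simpa using hM.eq_of_adj_right (h 0) (h 1)
  · refine (hcol _ _ ((SimpleGraph.deleteEdges_adj ..).2 ⟨?_, h⟩)).trans (hport i i' s)
    rcases s with j | s <;> simp [fbarOn_adj, fbarRel]

theorem connected_fbarOn_deleteEdges [Fintype J] [Fintype U] (hJU : 2 < Fintype.card (J ⊕ U))
    (hM : M.IsMatching) (hcard : 2 * Fintype.card J + 2 ≤ M.edgeSet.ncard) :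
    ((fbarOn J U).deleteEdges M.edgeSet).Connected := by
  have : Nonempty (FbarVertex J U) := ⟨.inl 0⟩
  refine ⟨preconnected_iff_forall_coloring.2 fun col hcol => ?_⟩
  have hclass := color_class_iff_color_port hJU hM hcard hcol
  obtain ⟨s₀⟩ : Nonempty (J ⊕ U) := Fintype.card_pos_iff.1 (by omega)
  suffices h : ∀ v, col (.inl 0) ↔ col v from fun v w => (h v).symm.trans (h w)
  rintro (i | ⟨j, i | c⟩ | s)
  · exact (hclass 0 0 s₀).trans (hclass i 0 s₀).symm
  · exact hclass 0 i (.inl j)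
  · exact (hclass 0 0 (.inl j)).trans (color_leaf_iff_color_hub hM hcol j 0 c)
  · exact hclass 0 0 (.inr s)

theorem mms_fbarOn_le [Fintype J] [Fintype U] (hJU : 2 < Fintype.card (J ⊕ U)) :
    mms (fbarOn J U) ≤ 2 * Fintype.card J + 1 := by
  refine csSup_le' ?_
  rintro _ ⟨M, hM, rfl⟩
  by_contra! hcard
  have hdel := connected_fbarOn_deleteEdges hJU hM.1 hcard
  have hcon := hdel.mono (SimpleGraph.deleteEdges_le _)
  exact ((isSeparatingMatching_iff_not_connected hcon).1 hM).2 hdel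

end MatchingsOfFbarOn

section FunkClass

variable {V : Type u} {W : Type v} {G : SimpleGraph V} {G' : SimpleGraph W} {k k' : Fin 4}

/-- The invariant of the induction over `FunkClass`: a connected cubic graph each of whose edges is
avoided by some 2-factor, and which has an almost 2-factor or is one of the four exceptions. -/
structure IsAdmissible (G : SimpleGraph V) : Prop where
  isRegular : IsRegular G 3
  connected : G.Connected
  edgesAvoidable : EdgesAvoidable G 2
  almostTwoFactor_or_iso : (∃ H, IsAlmostTwoFactor G H) ∨ ∃ k, Nonempty (G ≃g Fbar k)

theorem IsAdmissible.of_iso (e : G ≃g G') (h : IsAdmissible G') : IsAdmissible G where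
  isRegular := h.isRegular.of_iso e
  connected := e.connected_iff.2 h.connected
  edgesAvoidable := h.edgesAvoidable.of_iso e
  almostTwoFactor_or_iso := h.almostTwoFactor_or_iso.imp (fun ⟨_, hH⟩ => ⟨_, hH.comap e⟩)
    fun ⟨k, hk⟩ => ⟨k, hk.map e.trans⟩

theorem isAdmissible_heawood : IsAdmissible heawood where
  isRegular := isRegular_heawood
  connected := connected_heawood
  edgesAvoidable := edgesAvoidable_heawood
  almostTwoFactor_or_iso := by
    obtain ⟨H, hle, hdis, hH, h3⟩ := exists_isNearTwoFactor_heawood 0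
    exact .inl ⟨H, isAlmostTwoFactor_iff.2 ⟨hle, hdis, _, _, hH, h3⟩⟩

theorem isAdmissible_K33 : IsAdmissible K33 where
  isRegular := isRegular_K33
  connected := connected_K33
  edgesAvoidable := edgesAvoidable_K33
  almostTwoFactor_or_iso := .inr ⟨0, nonempty_fbar_zero_iso_K33.map SimpleGraph.Iso.symm⟩

theorem IsAdmissible.starProduct_heawood (h : IsAdmissible G) (a : V) (b : ZMod 7 ⊕ ZMod 7)
    (σ : G.neighborSet a ≃ heawood.neighborSet b) :
    IsAdmissible (starProduct G heawood a b σ) where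
  isRegular := h.isRegular.starProduct σ isRegular_heawood
  connected := connected_starProduct σ h.connected (connected_heawood_induce_compl b)
  edgesAvoidable := h.edgesAvoidable.starProduct edgesAvoidable_heawood h.isRegular
    isRegular_heawood
  almostTwoFactor_or_iso := by
    obtain ⟨s, hp, hq⟩ : ∃ s : ZMod 7, Sum.inl (4 + s) ≠ b ∧ Sum.inr (6 + s) ≠ b := by
      clear σ
      revert b
      decide
    obtain ⟨H, hle, hdis, hH, h3⟩ := exists_isNearTwoFactor_heawood s
    obtain ⟨F, hF⟩ := exists_isAlmostTwoFactor_starProduct_of_ne (σ := σ.symm) h.isRegular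
      h.edgesAvoidable hle hdis hH h3 hp hq
    exact .inl ⟨_, hF.comap (starProductComm σ)⟩

theorem IsAlmostTwoFactor.exists_starProduct_K33 {H : SimpleGraph V} (h : IsAlmostTwoFactor G H)
    {a : V} {b : Fin 3 ⊕ Fin 3} (σ : G.neighborSet a ≃ K33.neighborSet b) :
    ∃ H, IsAlmostTwoFactor (starProduct G K33 a b σ) H := by
  obtain ⟨hle, hdis, p, q, hH, h3⟩ := isAlmostTwoFactor_iff.1 h
  have : Nontrivial (Fin 3 ⊕ Fin 3) := ⟨.inl 0, .inr 0, Sum.inl_ne_inr⟩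
  by_cases ha : HasDisconnectedNearTwoFactor G a
  · exact exists_isAlmostTwoFactor_starProduct ha fun _ hT => exists_isNearTwoFactor_K33 hT
  refine exists_isAlmostTwoFactor_starProduct_of_ne isRegular_K33 edgesAvoidable_K33 hle hdis hH h3
    ?_ ?_ <;> rintro rfl
  · exact ha ⟨H, hle, hdis, h3 ▸ by decide, q, hH⟩
  · exact ha ⟨H, hle, hdis, hH.2.1 ▸ by decide, p, hH.symm h3⟩

theorem IsAdmissible.starProduct_K33 (h : IsAdmissible G) (a : V) (b : Fin 3 ⊕ Fin 3)
    (σ : G.neighborSet a ≃ K33.neighborSet b) : IsAdmissible (starProduct G K33 a b σ) where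
  isRegular := h.isRegular.starProduct σ isRegular_K33
  connected := connected_starProduct σ h.connected (connected_K33_induce_compl b)
  edgesAvoidable := h.edgesAvoidable.starProduct edgesAvoidable_K33 h.isRegular isRegular_K33
  almostTwoFactor_or_iso := by
    rcases h.almostTwoFactor_or_iso with ⟨H, hH⟩ | ⟨k, ⟨e⟩⟩
    · exact .inl (hH.exists_starProduct_K33 σ)
    · exact exists_isAlmostTwoFactor_or_iso_fbar_starProduct_K33 e σ

theorem FunkClass.isAdmissible (h : FunkClass G) : IsAdmissible G := by
  induction h with
  | heawood e => exact isAdmissible_heawood.of_iso e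
  | k33 e => exact isAdmissible_K33.of_iso e
  | starHeawood _ a b σ e ih => exact (ih.starProduct_heawood a b σ).of_iso e
  | starK33 _ a b σ e ih => exact (ih.starProduct_K33 a b σ).of_iso e

theorem funkClass_fbar_succ (hk : (k' : ℕ) = k + 1) (h : FunkClass (Fbar k)) :
    FunkClass (Fbar k') := by
  let s : Fin (3 - k) := ⟨0, by omega⟩
  obtain ⟨σ⟩ : Nonempty ((Fbar k).neighborSet (.inr (.inr s)) ≃ K33.neighborSet (.inl 0)) := by
    rw [← Finite.card_eq, Nat.card_coe_set_eq, Nat.card_coe_set_eq]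
    exact (h.isAdmissible.isRegular _).trans (isRegular_K33 _).symm
  let e : Fbar k ≃g fbarOn (Fin k) (Fin (3 - k)) :=
    ⟨.refl _, by rw [fbar_eq_fbarOn]; rfl⟩
  obtain ⟨k'', hk'', ⟨f⟩⟩ := exists_nonempty_starProduct_iso_fbar_succ e (s := s) rfl σ
  obtain rfl : k'' = k' := Fin.ext (hk''.trans hk.symm)
  exact .starK33 h _ (.inl 0) σ f.symm

theorem funkClass_fbar (k : Fin 4) : FunkClass (Fbar k) := by
  induction k using Fin.induction with
  | zero => exact nonempty_fbar_zero_iso_K33.elim .k33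
  | succ k ih => exact funkClass_fbar_succ (by simp) ih

theorem mms_le_of_iso_fbar (e : G ≃g Fbar k) : mms G ≤ 2 * k + 1 := by
  rw [mms_congr e, fbar_eq_fbarOn]
  refine (mms_fbarOn_le ?_).trans_eq (by rw [Fintype.card_fin])
  rw [Fintype.card_sum, Fintype.card_fin, Fintype.card_fin]
  omega

theorem card_of_iso_fbar (e : G ≃g Fbar k) : Nat.card V = 6 + 4 * k := by
  rw [Nat.card_congr e.toEquiv]
  simp only [Nat.card_eq_fintype_card, Fintype.card_sum, Fintype.card_prod, Fintype.card_fin]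
  omega

theorem half_card_sub_one_le_mms_iff [Fintype V] :
    (Fintype.card V : ℚ) / 2 - 1 ≤ mms G ↔ Nat.card V ≤ 2 * mms G + 2 := by
  rw [Nat.card_eq_fintype_card, ← Nat.cast_le (α := ℚ)]
  push_cast
  constructor <;> intro h <;> linarith

end FunkClass

end SeparatingMatching

theorem theorem4 :
    (∀ k : Fin 4, FunkClass (Fbar k)) ∧
    ∀ (V : Type u) [Fintype V] (G : SimpleGraph V), FunkClass G →
      (((mms G : ℚ) ≥ (Fintype.card V : ℚ) / 2 - 1 ↔ ∀ k : Fin 4, IsEmpty (G ≃g Fbar k)) ∧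
        ((∃ H : SimpleGraph V, IsAlmostTwoFactor G H) ↔ ∀ k : Fin 4, IsEmpty (G ≃g Fbar k))) := by
  refine ⟨funkClass_fbar, fun V _ G hG => ?_⟩
  have hadm := hG.isAdmissible
  rw [ge_iff_le, half_card_sub_one_le_mms_iff]
  have hbound : (∃ H, IsAlmostTwoFactor G H) → Nat.card V ≤ 2 * mms G + 2 := fun ⟨_, hH⟩ =>
    card_le_two_mul_mms_add_two hadm.isRegular hadm.connected hH
  have hexcl : Nat.card V ≤ 2 * mms G + 2 → ∀ k, IsEmpty (G ≃g Fbar k) := fun h k => ⟨fun e => by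
    have := mms_le_of_iso_fbar e
    have := card_of_iso_fbar e
    omega⟩
  have hexists : (∀ k, IsEmpty (G ≃g Fbar k)) → ∃ H, IsAlmostTwoFactor G H := fun h =>
    hadm.almostTwoFactor_or_iso.resolve_right fun ⟨k, ⟨e⟩⟩ => (h k).false e
  exact ⟨⟨hexcl, hbound ∘ hexists⟩, ⟨hexcl ∘ hbound, hexists⟩⟩
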